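/- A finite ordered rooted tree $T$ is drawn in the plane with nodes at grid points and every edge drawn as a polygonal line (possibly with bends) whose bends are grid points. The drawing is planar if it has no crossings, and order-preserving if at every node the edge to the parent (if any) and the edges to the children, in their given order, appear in this cyclic order counterclockwise. For a path $\pi=\langle v_1,\dots,v_\ell\rangle$ from the root to a leaf, a left (right) subtree of $\pi$ is a subtree rooted at a child of some $v_i$, $i<\ell$, that comes before (after) $v_{i+1}$ in the order of the children of $v_i$. A GLR-drawing of $T$ is an order-preserving planar drawing of $T$ such that it, and the drawing that it induces on each rooted subtree, satisfies the following conditions: there is a root-to-leaf path $\pi=\langle v_1,\dots,v_\ell\rangle$ that is drawn on a vertical line with $v_i$ above $v_{i+1}$ for $1\le i<\ell$; and the column containing $\pi$ separates the drawings of the left and right subtrees of $\pi$, that is, the drawing of each left or right subtree (without the edge that joins it to $\pi$) does not use this column, and a left subtree and a right subtree always lie on opposite sides of it. The width of a drawing is the number of grid columns that intersect it. Corollary. There is a constant $c>0$ such that for every positive integer $n$ there is an ordered rooted tree $T$ with $n$ nodes such that every GLR-drawing of $T$ has width at least $c\,n^{0.429}$. -/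

import Mathlib

/-- A finite ordered rooted tree. A node is named by the sequence of child indices that leads
to it from the root `[]`; the children of `v` are `v ++ [0], v ++ [1], …`, in this order from
left to right. Every finite ordered rooted tree has exactly one such encoding. -/
structure OrderedTree where
  nodes : Finset (List ℕ)
  root_mem : [] ∈ nodes
  parent_mem : ∀ (v : List ℕ) (i : ℕ), v ++ [i] ∈ nodes → v ∈ nodes
  sibling_mem : ∀ (v : List ℕ) (i j : ℕ), j ≤ i → v ++ [i] ∈ nodes → v ++ [j] ∈ nodes

namespace OrderedTree

/-- The edges of `T`, each named by its lower endpoint `c`; it joins `c` to the parent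
`c.dropLast`. -/
def IsEdge (T : OrderedTree) (c : List ℕ) : Prop := c ∈ T.nodes ∧ c ≠ []

/-- `l` is a node without children. -/
def IsLeaf (T : OrderedTree) (l : List ℕ) : Prop :=
  l ∈ T.nodes ∧ ∀ i : ℕ, l ++ [i] ∉ T.nodes

end OrderedTree

/-- The node `u` lies on the path that leads from `r` down to its descendant `l`. -/
def OnPath (r l u : List ℕ) : Prop := r <+: u ∧ u <+: l

/-- `c` is the root of a left subtree of the path from `r` to `l`: its parent `u` and the child
`u ++ [k]` of `u` are on the path, and `c` comes before that path-child in the order at `u`. -/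
def OrderedTree.IsLeftSubtree (T : OrderedTree) (r l c : List ℕ) : Prop :=
  ∃ (u : List ℕ) (j k : ℕ), c = u ++ [j] ∧ c ∈ T.nodes ∧
    OnPath r l u ∧ OnPath r l (u ++ [k]) ∧ j < k

/-- `c` is the root of a right subtree of the path from `r` to `l`. -/
def OrderedTree.IsRightSubtree (T : OrderedTree) (r l c : List ℕ) : Prop :=
  ∃ (u : List ℕ) (j k : ℕ), c = u ++ [j] ∧ c ∈ T.nodes ∧
    OnPath r l u ∧ OnPath r l (u ++ [k]) ∧ k < j

/-- The plane is `ℂ`; the second coordinate (the imaginary part) grows upwards. -/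
def gridPoint (p : ℤ × ℤ) : ℂ := ⟨(p.1 : ℝ), (p.2 : ℝ)⟩

/-- The set of points on the polygonal line with the given successive vertices. -/
def polyline (L : List ℂ) : Set ℂ :=
  {p | ∃ (i : ℕ) (h : i + 1 < L.length), p ∈ segment ℝ L[i] L[i + 1]}

/-- The polygonal line does not touch itself: its vertices are distinct, consecutive segments
share only their common vertex, and other pairs of segments are disjoint (there `L[i + 1]` and
`L[j]` are different points). -/
def SimplePolyline (L : List ℂ) : Prop :=
  L.Nodup ∧ ∀ (i j : ℕ) (hij : i < j) (hj : j + 1 < L.length),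
    ∀ p ∈ segment ℝ L[i] L[i + 1] ∩ segment ℝ L[j] L[j + 1], p = L[i + 1] ∧ p = L[j]

/-- The angle in `[0, 2π)` by which the direction `a` has to be turned counterclockwise to reach
the direction `b`. -/
noncomputable def ccwAngle (a b : ℂ) : ℝ :=
  toIcoMod Real.two_pi_pos 0 (Complex.arg (b / a))

/-- A polyline drawing on the grid: a grid point for every node, and for the edge from
`c.dropLast` to `c` the list of its bends (possibly empty), which are grid points, in the order
in which they are met from `c.dropLast` to `c`. Only values at nodes of `T` matter. -/
structure TreeDrawing (T : OrderedTree) where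
  pos : List ℕ → ℤ × ℤ
  bends : List ℕ → List (ℤ × ℤ)

namespace TreeDrawing

variable {T : OrderedTree}

/-- The polygonal line that represents the edge from `c.dropLast` to `c`. -/
def edgeVertices (Γ : TreeDrawing T) (c : List ℕ) : List ℂ :=
  (Γ.pos c.dropLast :: (Γ.bends c ++ [Γ.pos c])).map gridPoint

def edgeCurve (Γ : TreeDrawing T) (c : List ℕ) : Set ℂ := polyline (Γ.edgeVertices c)

/-- The drawing has no crossings: different nodes are at different points, every edge is a simple
curve, an edge contains no nodes but its endpoints, and two edges share nothing but
common endpoints. -/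
def IsPlanar (Γ : TreeDrawing T) : Prop :=
  Set.InjOn Γ.pos (T.nodes : Set (List ℕ)) ∧
  (∀ c, T.IsEdge c → SimplePolyline (Γ.edgeVertices c)) ∧
  (∀ c, T.IsEdge c → ∀ w ∈ T.nodes, gridPoint (Γ.pos w) ∈ Γ.edgeCurve c →
    w = c ∨ w = c.dropLast) ∧
  (∀ c d, T.IsEdge c → T.IsEdge d → c ≠ d → ∀ p ∈ Γ.edgeCurve c ∩ Γ.edgeCurve d,
    ∃ w : List ℕ, (w = c ∨ w = c.dropLast) ∧ (w = d ∨ w = d.dropLast) ∧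
      p = gridPoint (Γ.pos w))

/-- The direction in which the edge to the `i`-th child leaves `v`. -/
def childDir (Γ : TreeDrawing T) (v : List ℕ) (i : ℕ) : ℂ :=
  gridPoint ((Γ.bends (v ++ [i])).headD (Γ.pos (v ++ [i]))) - gridPoint (Γ.pos v)

/-- The direction in which the edge to the parent leaves `v ≠ []`. -/
def parentDir (Γ : TreeDrawing T) (v : List ℕ) : ℂ :=
  gridPoint ((Γ.bends v).getLastD (Γ.pos v.dropLast)) - gridPoint (Γ.pos v)

/-- At every node, the edge to the parent (if there is one) and the edges to the children, in
their given order, leave in this cyclic order counterclockwise. (With the parent on top and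
the children below, this is the order from left to right.) -/
def IsOrderPreserving (Γ : TreeDrawing T) : Prop :=
  ∀ (v : List ℕ) (i j : ℕ), i < j → v ++ [j] ∈ T.nodes →
    ccwAngle (if v = [] then Γ.childDir v 0 else Γ.parentDir v) (Γ.childDir v i) <
      ccwAngle (if v = [] then Γ.childDir v 0 else Γ.parentDir v) (Γ.childDir v j)

/-- The induced drawing of the subtree rooted at `r`, as a set of points: all nodes of the
subtree and all edges between them (the edge from `r` to its parent is not included). -/
def subtreePoints (Γ : TreeDrawing T) (r : List ℕ) : Set ℂ :=
  {p | ∃ w ∈ T.nodes, r <+: w ∧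
    (p = gridPoint (Γ.pos w) ∨ (w ≠ r ∧ p ∈ Γ.edgeCurve w))}

/-- The path from `r` to `l` is drawn on the column `x`, downwards. -/
def VerticalPath (Γ : TreeDrawing T) (r l : List ℕ) (x : ℤ) : Prop :=
  (∀ u, OnPath r l u → (Γ.pos u).1 = x) ∧
  (∀ (u : List ℕ) (k : ℕ), OnPath r l u → OnPath r l (u ++ [k]) →
    (Γ.pos (u ++ [k])).2 < (Γ.pos u).2 ∧
    ∀ p ∈ Γ.edgeCurve (u ++ [k]), p.re = (x : ℝ))

/-- The column `x` separates the left subtrees of the path from `r` to `l` from the right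
subtrees: it is not used by the drawing of any of them, and a left subtree and a right
subtree are always on opposite sides of it. -/
def PathSeparation (Γ : TreeDrawing T) (r l : List ℕ) (x : ℤ) : Prop :=
  (∀ c, T.IsLeftSubtree r l c ∨ T.IsRightSubtree r l c →
    ∀ p ∈ Γ.subtreePoints c, p.re ≠ (x : ℝ)) ∧
  (∀ c d, T.IsLeftSubtree r l c → T.IsRightSubtree r l d →
    ((∀ p ∈ Γ.subtreePoints c, p.re < (x : ℝ)) ∧ ∀ q ∈ Γ.subtreePoints d, (x : ℝ) < q.re) ∨
    ((∀ p ∈ Γ.subtreePoints c, (x : ℝ) < p.re) ∧ ∀ q ∈ Γ.subtreePoints d, q.re < (x : ℝ)))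

/-- A generalized LR-drawing: an order-preserving planar drawing such that for every rooted
subtree (the whole tree included) some root-to-leaf path of the subtree is drawn vertically
and its column separates the left and the right subtrees of the path. -/
def IsGLR (Γ : TreeDrawing T) : Prop :=
  Γ.IsPlanar ∧ Γ.IsOrderPreserving ∧
  ∀ r ∈ T.nodes, ∃ (l : List ℕ) (x : ℤ), T.IsLeaf l ∧ r <+: l ∧
    Γ.VerticalPath r l x ∧ Γ.PathSeparation r l x

/-- The number of grid columns that intersect the drawing. -/
noncomputable def width (Γ : TreeDrawing T) : ℕ :=
  {x : ℤ | ∃ p ∈ Γ.subtreePoints [], p.re = (x : ℝ)}.ncard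

end TreeDrawing

/-! Planarity and order preservation are not needed. In a GLR-drawing the columns of a left subtree,
those of a right subtree and the column of the path are disjoint. So for the chosen path the width
is at least 1 plus the largest left width plus the largest right width (`IsGLR.widthAssignment`). It
remains to build small trees in which every path, whichever one is chosen, makes this sum large.

To force width `w = t + m + 1`, take a spine of `m` nodes that ends in copies of a tree forcing `t`;
the spine node with entry `e` carries on each side a tree forcing `e`. A path that follows the spine
along a prefix `p` meets the side trees of `p` on both sides; by infix domination some entry of `p`
is at least its length, so both sides have width at least `p.length`. Where the path leaves the
spine, the whole rest lies on one side and recursively forces `t` plus its length plus 1. The two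
bounds add up (`le_add_of_pathBound_spine`).

Placing `m` in the middle of the list and recursing on the halves gives an infix-dominated list in
which the sum of `e ^ p` is at most `m ^ p / (1 - 2 ^ (1 - p))`. For `p = 1000 / 429` and `t ≈ 19 w
/ 32` the size recurrence then closes with size `O(w ^ p)` (`exists_forcesWidth`); inverting gives
the exponent 0.429. -/

namespace OrderedTree

/-! ### Forced width as a property of the tree alone -/

/-- Every left subtree of the path from `r` to `l` has `ω`-value at most `x`, every right subtree
at most `y`. -/
def PathBound (T : OrderedTree) (ω : List ℕ → ℕ) (r l : List ℕ) (x y : ℕ) : Prop :=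
  (∀ c, T.IsLeftSubtree r l c → ω c ≤ x) ∧ ∀ c, T.IsRightSubtree r l c → ω c ≤ y

/-- The recursive lower bound that the widths of the subtrees satisfy in a GLR-drawing. -/
def WidthAssignment (T : OrderedTree) (ω : List ℕ → ℕ) : Prop :=
  ∀ r ∈ T.nodes, ∃ (l : List ℕ) (x y : ℕ), T.IsLeaf l ∧ r <+: l ∧ T.PathBound ω r l x y ∧
    x + y + 1 ≤ ω r

/-- Every root-to-leaf path of `T` has side subtrees that require total width `w`. -/
def ForcesWidth (T : OrderedTree) (w : ℕ) : Prop :=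
  ∀ ω, T.WidthAssignment ω → ∀ l x y, T.IsLeaf l → T.PathBound ω [] l x y → w ≤ x + y + 1

theorem ForcesWidth.le {T : OrderedTree} {w : ℕ} (h : T.ForcesWidth w) {ω : List ℕ → ℕ}
    (hω : T.WidthAssignment ω) : w ≤ ω [] := by
  obtain ⟨l, x, y, hl, -, hb, hxy⟩ := hω [] T.root_mem
  exact (h ω hω l x y hl hb).trans hxy

/-! ### Joining trees under a new root -/

/-- The tree with one node. -/
def leaf : OrderedTree where
  nodes := {[]}
  root_mem := by simp
  parent_mem := by simp
  sibling_mem := by simp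

theorem forcesWidth_one (T : OrderedTree) : T.ForcesWidth 1 := fun _ _ _ _ _ _ _ => by omega

/-- The node set of the tree whose root has the subtrees `L`. -/
def joinNodes (L : List OrderedTree) : Finset (List ℕ) :=
  insert [] ((Finset.range L.length).biUnion fun i =>
    (((L.map nodes)[i]?).getD ∅).image (List.cons i))

theorem mem_joinNodes {L : List OrderedTree} {v : List ℕ} :
    v ∈ joinNodes L ↔ v = [] ∨ ∃ (i : ℕ) (S : OrderedTree) (u : List ℕ),
      L[i]? = some S ∧ u ∈ S.nodes ∧ v = i :: u := by
  simp only [joinNodes, Finset.mem_insert, Finset.mem_biUnion, Finset.mem_range,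
    Finset.mem_image]
  refine or_congr Iff.rfl ⟨?_, ?_⟩
  · rintro ⟨i, hi, u, hu, rfl⟩
    refine ⟨i, L[i], u, by simp [hi], ?_, rfl⟩
    simpa [hi] using hu
  · rintro ⟨i, S, u, hS, hu, rfl⟩
    obtain ⟨hi, rfl⟩ := List.getElem?_eq_some_iff.mp hS
    exact ⟨i, hi, u, by simpa [hi] using hu, rfl⟩

/-- The tree whose root has the subtrees `L`, from left to right. -/
def join (L : List OrderedTree) : OrderedTree where
  nodes := joinNodes L
  root_mem := mem_joinNodes.mpr (Or.inl rfl)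
  parent_mem := by
    intro v i h
    rw [mem_joinNodes] at h ⊢
    rcases h with h | ⟨k, S, u, hS, hu, h⟩
    · simp at h
    · rcases v with _ | ⟨a, v⟩
      · exact Or.inl rfl
      · simp only [List.cons_append, List.cons.injEq] at h
        obtain ⟨rfl, rfl⟩ := h
        exact Or.inr ⟨a, S, v, hS, S.parent_mem v i hu, rfl⟩
  sibling_mem := by
    intro v i j hji h
    rw [mem_joinNodes] at h ⊢
    rcases h with h | ⟨k, S, u, hS, hu, h⟩
    · simp at h
    · right
      rcases v with _ | ⟨a, v⟩
      · simp only [List.nil_append, List.cons.injEq] at h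
        obtain ⟨rfl, rfl⟩ := h
        obtain ⟨hi, -⟩ := List.getElem?_eq_some_iff.mp hS
        exact ⟨j, L[j], [], by simp [hji.trans_lt hi], L[j].root_mem, rfl⟩
      · simp only [List.cons_append, List.cons.injEq] at h
        obtain ⟨rfl, rfl⟩ := h
        exact ⟨a, S, v ++ [j], hS, S.sibling_mem v i j hji hu, rfl⟩

theorem cons_mem_join {L : List OrderedTree} {i : ℕ} {S : OrderedTree} (hS : L[i]? = some S)
    {u : List ℕ} : i :: u ∈ (join L).nodes ↔ u ∈ S.nodes := by
  refine mem_joinNodes.trans ⟨?_, fun h => Or.inr ⟨i, S, u, hS, h, rfl⟩⟩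
  rintro (h | ⟨j, S', u', hS', hu, h⟩)
  · simp at h
  · obtain ⟨rfl, rfl⟩ := List.cons.inj h
    rw [hS] at hS'
    obtain rfl := Option.some.inj hS'
    exact hu

theorem isLeaf_cons {L : List OrderedTree} {i : ℕ} {S : OrderedTree} (hS : L[i]? = some S)
    {u : List ℕ} : (join L).IsLeaf (i :: u) ↔ S.IsLeaf u := by
  simp only [IsLeaf, List.cons_append, cons_mem_join hS]

theorem exists_cons_of_isLeaf_join {L : List OrderedTree} (hL : L ≠ []) {l : List ℕ}
    (hl : (join L).IsLeaf l) :
    ∃ (i : ℕ) (S : OrderedTree) (u : List ℕ), L[i]? = some S ∧ S.IsLeaf u ∧ l = i :: u := by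
  rcases mem_joinNodes.mp hl.1 with rfl | ⟨i, S, u, hS, hu, rfl⟩
  · obtain ⟨S, L', rfl⟩ := List.exists_cons_of_ne_nil hL
    exact absurd ((cons_mem_join (L := S :: L') (i := 0) (S := S) rfl).mpr S.root_mem) (hl.2 0)
  · exact ⟨i, S, u, hS, (isLeaf_cons hS).mp hl, rfl⟩

theorem onPath_cons {i : ℕ} {r l u : List ℕ} (h : OnPath r l u) :
    OnPath (i :: r) (i :: l) (i :: u) :=
  ⟨List.cons_prefix_cons.mpr ⟨rfl, h.1⟩, List.cons_prefix_cons.mpr ⟨rfl, h.2⟩⟩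

theorem onPath_nil_of_onPath {r l u : List ℕ} (h : OnPath r l u) : OnPath [] l u :=
  ⟨List.nil_prefix, h.2⟩

theorem isLeftSubtree_cons {L : List OrderedTree} {i : ℕ} {S : OrderedTree}
    (hS : L[i]? = some S) {r l c : List ℕ} (h : S.IsLeftSubtree r l c) :
    (join L).IsLeftSubtree (i :: r) (i :: l) (i :: c) := by
  obtain ⟨u, j, k, rfl, hc, hu, hk, hjk⟩ := h
  exact ⟨i :: u, j, k, rfl, (cons_mem_join hS).mpr hc, onPath_cons hu, onPath_cons hk, hjk⟩

theorem isRightSubtree_cons {L : List OrderedTree} {i : ℕ} {S : OrderedTree}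
    (hS : L[i]? = some S) {r l c : List ℕ} (h : S.IsRightSubtree r l c) :
    (join L).IsRightSubtree (i :: r) (i :: l) (i :: c) := by
  obtain ⟨u, j, k, rfl, hc, hu, hk, hjk⟩ := h
  exact ⟨i :: u, j, k, rfl, (cons_mem_join hS).mpr hc, onPath_cons hu, onPath_cons hk, hjk⟩

theorem IsLeftSubtree.nil {T : OrderedTree} {r l c : List ℕ} (h : T.IsLeftSubtree r l c) :
    T.IsLeftSubtree [] l c := by
  obtain ⟨u, j, k, hc, hcT, hu, hk, hjk⟩ := h
  exact ⟨u, j, k, hc, hcT, onPath_nil_of_onPath hu, onPath_nil_of_onPath hk, hjk⟩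

theorem IsRightSubtree.nil {T : OrderedTree} {r l c : List ℕ} (h : T.IsRightSubtree r l c) :
    T.IsRightSubtree [] l c := by
  obtain ⟨u, j, k, hc, hcT, hu, hk, hjk⟩ := h
  exact ⟨u, j, k, hc, hcT, onPath_nil_of_onPath hu, onPath_nil_of_onPath hk, hjk⟩

theorem WidthAssignment.child {L : List OrderedTree} {ω : List ℕ → ℕ}
    (hω : (join L).WidthAssignment ω) {i : ℕ} {S : OrderedTree} (hS : L[i]? = some S) :
    S.WidthAssignment fun u => ω (i :: u) := by
  intro r hr
  obtain ⟨l, x, y, hl, hrl, hb, hxy⟩ := hω (i :: r) ((cons_mem_join hS).mpr hr)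
  obtain ⟨l, rfl⟩ : ∃ l', l = i :: l' := by
    obtain ⟨s, rfl⟩ := hrl
    exact ⟨r ++ s, rfl⟩
  exact ⟨l, x, y, (isLeaf_cons hS).mp hl, (List.cons_prefix_cons.mp hrl).2,
    ⟨fun c hc => hb.1 _ (isLeftSubtree_cons hS hc),
      fun c hc => hb.2 _ (isRightSubtree_cons hS hc)⟩, hxy⟩

theorem PathBound.child {L : List OrderedTree} {ω : List ℕ → ℕ} {i x y : ℕ} {l : List ℕ}
    (hb : (join L).PathBound ω [] (i :: l) x y) {S : OrderedTree} (hS : L[i]? = some S) :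
    S.PathBound (fun u => ω (i :: u)) [] l x y :=
  ⟨fun _ hc => hb.1 _ (isLeftSubtree_cons hS hc).nil,
    fun _ hc => hb.2 _ (isRightSubtree_cons hS hc).nil⟩

theorem onPath_root_child {i : ℕ} {l : List ℕ} : OnPath [] (i :: l) ([] ++ [i]) :=
  ⟨List.nil_prefix, by simp⟩

theorem PathBound.left_le {L : List OrderedTree} {ω : List ℕ → ℕ} {i x y : ℕ} {l : List ℕ}
    (hb : (join L).PathBound ω [] (i :: l) x y) (hω : (join L).WidthAssignment ω) {j w : ℕ}
    (hj : j < i) {S : OrderedTree} (hS : L[j]? = some S) (hw : S.ForcesWidth w) : w ≤ x :=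
  (hw.le (hω.child hS)).trans (hb.1 _ ⟨[], j, i, rfl, (cons_mem_join hS).mpr S.root_mem,
    ⟨List.nil_prefix, List.nil_prefix⟩, onPath_root_child, hj⟩)

theorem PathBound.right_le {L : List OrderedTree} {ω : List ℕ → ℕ} {i x y : ℕ} {l : List ℕ}
    (hb : (join L).PathBound ω [] (i :: l) x y) (hω : (join L).WidthAssignment ω) {j w : ℕ}
    (hj : i < j) {S : OrderedTree} (hS : L[j]? = some S) (hw : S.ForcesWidth w) : w ≤ y :=
  (hw.le (hω.child hS)).trans (hb.2 _ ⟨[], j, i, rfl, (cons_mem_join hS).mpr S.root_mem,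
    ⟨List.nil_prefix, List.nil_prefix⟩, onPath_root_child, hj⟩)

theorem exists_of_isLeaf_join_three {A B C : OrderedTree} {l : List ℕ}
    (hl : (join [A, B, C]).IsLeaf l) :
    (∃ u, A.IsLeaf u ∧ l = 0 :: u) ∨ (∃ u, B.IsLeaf u ∧ l = 1 :: u) ∨
      ∃ u, C.IsLeaf u ∧ l = 2 :: u := by
  obtain ⟨i, S, u, hS, hu, rfl⟩ := exists_cons_of_isLeaf_join (by simp) hl
  match i, hS with
  | 0, hS => cases hS; exact Or.inl ⟨u, hu, rfl⟩
  | 1, hS => cases hS; exact Or.inr (Or.inl ⟨u, hu, rfl⟩)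
  | 2, hS => cases hS; exact Or.inr (Or.inr ⟨u, hu, rfl⟩)

/-- The path chosen for the larger tree need not restrict to the one chosen for `T`. The bound
survives because `ForcesWidth` speaks of all paths, not only of `ω []`. -/
theorem ForcesWidth.join_singleton {T : OrderedTree} {w : ℕ} (h : T.ForcesWidth w) :
    (join [T]).ForcesWidth w := by
  intro ω hω l x y hl hb
  obtain ⟨i, S, u, hS, hu, rfl⟩ := exists_cons_of_isLeaf_join (by simp) hl
  match i, hS with
  | 0, hS => cases hS; exact h _ (hω.child (i := 0) rfl) u x y hu (hb.child rfl)

theorem card_join_singleton (T : OrderedTree) : (join [T]).nodes.card = T.nodes.card + 1 := by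
  have : (join [T]).nodes = insert [] (T.nodes.image (List.cons 0)) := by
    simp [join, joinNodes]
  rw [this, Finset.card_insert_of_notMem (by simp),
    Finset.card_image_of_injective _ List.cons_injective]

theorem card_join_three_le (A B C : OrderedTree) :
    (join [A, B, C]).nodes.card ≤ A.nodes.card + B.nodes.card + C.nodes.card + 1 := by
  refine (Finset.card_insert_le _ _).trans (Nat.succ_le_succ (Finset.card_biUnion_le.trans ?_))
  simp only [List.length_cons, List.length_nil, Finset.sum_range_succ, Finset.sum_range_zero]
  simpa using add_le_add (add_le_add Finset.card_image_le Finset.card_image_le)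
    Finset.card_image_le

/-- Chains on top of `T` bring it to any larger number of nodes. -/
theorem ForcesWidth.exists_card_eq {T : OrderedTree} {w : ℕ} (h : T.ForcesWidth w) {n : ℕ}
    (hn : T.nodes.card ≤ n) : ∃ T' : OrderedTree, T'.nodes.card = n ∧ T'.ForcesWidth w := by
  induction n, hn using Nat.le_induction with
  | base => exact ⟨T, rfl, h⟩
  | succ n _ ih =>
    obtain ⟨T', hc, hw⟩ := ih
    exact ⟨join [T'], by rw [card_join_singleton, hc], hw.join_singleton⟩

/-! ### Spines and the width they force -/

/-- A path of nodes that ends at the root of `K`; the node of the entry `e` carries a copy of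
`f e` on each side. -/
def spine (f : ℕ → OrderedTree) (K : OrderedTree) : List ℕ → OrderedTree
  | [] => K
  | e :: q => join [f e, spine f K q, f e]

/-- Every contiguous part of the list has an entry that is at least its length. -/
def InfixDominated (q : List ℕ) : Prop :=
  ∀ p, p <:+: q → p ≠ [] → ∃ e ∈ p, p.length ≤ e

theorem InfixDominated.infix {p q : List ℕ} (h : InfixDominated q) (hp : p <:+: q) :
    InfixDominated p := fun s hs => h s (hs.trans hp)

theorem InfixDominated.length_le {p q : List ℕ} (h : InfixDominated (p ++ q)) {x : ℕ}
    (hx : ∀ e ∈ p, e ≤ x) : p.length ≤ x := by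
  rcases eq_or_ne p [] with rfl | hp
  · simp
  · obtain ⟨e, he, hle⟩ := h p (List.prefix_append p q).isInfix hp
    exact hle.trans (hx e he)

/-- Induction along the spine, with `p` the part already passed; its side trees are recorded only
through the bounds of its entries by `x` and `y`. -/
theorem le_add_of_pathBound_spine {f : ℕ → OrderedTree} {T : OrderedTree} {t : ℕ}
    (hT : T.ForcesWidth t) (q : List ℕ) :
    ∀ p, InfixDominated (p ++ q) → (∀ e ∈ p ++ q, (f e).ForcesWidth e) →
      ∀ ω, (spine f (join [leaf, T, T]) q).WidthAssignment ω → ∀ l x y,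
        (spine f (join [leaf, T, T]) q).IsLeaf l →
        (spine f (join [leaf, T, T]) q).PathBound ω [] l x y →
        (∀ e ∈ p, e ≤ x) → (∀ e ∈ p, e ≤ y) → t + (p ++ q).length ≤ x + y := by
  induction q with
  | nil =>
    intro p hp hf ω hω l x y hl hb hx hy
    have h1 := hp.length_le hx
    have h2 := hp.length_le hy
    simp only [List.append_nil]
    -- Two copies of `T` ensure that one is always off the path; `leaf` only makes up the third
    -- child.
    rcases exists_of_isLeaf_join_three hl with ⟨u, hu, rfl⟩ | ⟨u, hu, rfl⟩ | ⟨u, hu, rfl⟩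
    · have := hb.right_le hω (j := 1) (by simp) rfl hT
      omega
    · have := hb.right_le hω (j := 2) (by simp) rfl hT
      omega
    · have := hb.left_le hω (j := 1) (by simp) rfl hT
      omega
  | cons e q ih =>
    intro p hp hf ω hω l x y hl hb hx hy
    have h1 := hp.length_le hx
    have h2 := hp.length_le hy
    -- As a side subtree the rest of the spine gets a path of its own, so the induction restarts
    -- with an empty prefix. This is why domination is needed for all infixes.
    have hq : (spine f (join [leaf, T, T]) q).ForcesWidth (t + q.length + 1) := by
      intro ω' hω' l' x' y' hl' hb'
      have := ih [] (hp.infix ⟨p ++ [e], [], by simp⟩) (fun e' he' => hf e' (by simp_all))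
        ω' hω' l' x' y' hl' hb' (by simp) (by simp)
      simp only [List.nil_append] at this
      omega
    have he := hf e (by simp)
    simp only [List.length_append, List.length_cons]
    rcases exists_of_isLeaf_join_three hl with ⟨u, hu, rfl⟩ | ⟨u, hu, rfl⟩ | ⟨u, hu, rfl⟩
    · have := hb.right_le hω (j := 1) (by simp) rfl hq
      omega
    · have hex := hb.left_le hω (j := 0) (by simp) rfl he
      have hey := hb.right_le hω (j := 2) (by simp) rfl he
      have := ih (p ++ [e]) (by simpa using hp) (by simpa using hf) _ (hω.child (i := 1) rfl)
        u x y hu (hb.child rfl) (by simp; grind) (by simp; grind)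
      simp only [List.length_append, List.length_cons, List.length_nil] at this
      omega
    · have := hb.left_le hω (j := 1) (by simp) rfl hq
      omega

theorem forcesWidth_spine {f : ℕ → OrderedTree} {T : OrderedTree} {t : ℕ}
    (hT : T.ForcesWidth t) {q : List ℕ} (hq : InfixDominated q)
    (hf : ∀ e ∈ q, (f e).ForcesWidth e) :
    (spine f (join [leaf, T, T]) q).ForcesWidth (t + q.length + 1) := by
  intro ω hω l x y hl hb
  have := le_add_of_pathBound_spine hT q [] hq hf ω hω l x y hl hb (by simp) (by simp)
  simp only [List.nil_append] at this
  omega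

theorem card_spine_le (f : ℕ → OrderedTree) (K : OrderedTree) (q : List ℕ) :
    (spine f K q).nodes.card ≤
      2 * (q.map fun e => (f e).nodes.card).sum + q.length + K.nodes.card := by
  induction q with
  | nil => simp [spine]
  | cons e q ih =>
    have := card_join_three_le (f e) (spine f K q) (f e)
    simp only [spine, List.map_cons, List.sum_cons, List.length_cons]
    omega

/-! ### Infix-dominated lists by halving -/

/-- The cheapest infix-dominated list of length `m`, found by halving. -/
def halvingList : ℕ → List ℕ
  | 0 => []
  | m + 1 => halvingList ((m + 1) / 2) ++ (m + 1) :: halvingList (m / 2)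
termination_by m => m
decreasing_by all_goals omega

theorem length_halvingList (m : ℕ) : (halvingList m).length = m := by
  induction m using Nat.strong_induction_on with
  | _ m ih =>
    match m with
    | 0 => simp [halvingList]
    | m + 1 =>
      rw [halvingList, List.length_append, List.length_cons, ih _ (by omega), ih _ (by omega)]
      omega

theorem infix_append_cons {α : Type*} {p A B : List α} {a : α} (h : p <:+: A ++ a :: B) :
    a ∈ p ∨ p <:+: A ∨ p <:+: B := by
  obtain ⟨s, t, h⟩ := h
  rw [List.append_assoc] at h
  rcases List.append_eq_append_iff.mp h with ⟨c, h1, h2⟩ | ⟨c, h1, h2⟩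
  · rcases List.append_eq_append_iff.mp h2 with ⟨d, h3, h4⟩ | ⟨d, h3, h4⟩
    · right; left
      exact ⟨s, d, by rw [h1, h3, List.append_assoc]⟩
    · rcases d with _ | ⟨b, d⟩
      · right; left
        exact ⟨s, [], by simp_all⟩
      · left
        simp_all
  · rcases c with _ | ⟨b, c⟩
    · rcases p with _ | ⟨b, p⟩
      · right; left; exact ⟨[], A, by simp⟩
      · left
        simp_all
    · right; right
      simp only [List.cons_append, List.cons.injEq] at h2
      exact ⟨c, t, by rw [h2.2, List.append_assoc]⟩

/-- An infix either contains the middle entry, which is the length of the whole list, or lies within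
one half. -/
theorem infixDominated_halvingList (m : ℕ) : InfixDominated (halvingList m) := by
  induction m using Nat.strong_induction_on with
  | _ m ih =>
    match m with
    | 0 =>
      intro p hp hne
      simp only [halvingList, List.infix_nil] at hp
      exact absurd hp hne
    | m + 1 =>
      intro p hp hne
      have hlen := hp.length_le
      rw [length_halvingList] at hlen
      rw [halvingList] at hp
      rcases infix_append_cons hp with h | h | h
      · exact ⟨_, h, hlen⟩
      · exact ih _ (by omega) p h hne
      · exact ih _ (by omega) p h hne

theorem mem_halvingList {m e : ℕ} (h : e ∈ halvingList m) : 1 ≤ e ∧ e ≤ m := by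
  induction m using Nat.strong_induction_on with
  | _ m ih =>
    match m with
    | 0 => simp [halvingList] at h
    | m + 1 =>
      rw [halvingList, List.mem_append, List.mem_cons] at h
      rcases h with h | rfl | h
      · have := ih _ (by omega) h
        omega
      · omega
      · have := ih _ (by omega) h
        omega

/-! ### Size estimates -/

theorem rpow_exponent_le {a b : ℝ} (ha : 0 ≤ a) (hb : 0 ≤ b) (h : a ^ 1000 ≤ b ^ 429) :
    a ^ (1000 / 429 : ℝ) ≤ b := by
  refine le_of_pow_le_pow_left₀ (n := 429) (by norm_num) hb ?_
  rw [← Real.rpow_natCast, ← Real.rpow_mul ha]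
  norm_num
  exact_mod_cast h

set_option exponentiation.threshold 1000 in
theorem sum_halvingList_rpow_le (m : ℕ) :
    ((halvingList m).map fun e : ℕ => (e : ℝ) ^ (1000 / 429 : ℝ)).sum ≤
      1.6598 * (m : ℝ) ^ (1000 / 429 : ℝ) := by
  -- Both halves together cost at most the fraction 0.3975 of the whole, and `1 + 0.3975 * 1.6598 ≤
  -- 1.6598`.
  have h2 : (1 / 2 : ℝ) ^ (1000 / 429 : ℝ) ≤ 0.3975 / 2 :=
    rpow_exponent_le (by norm_num) (by norm_num) (by norm_num)
  induction m using Nat.strong_induction_on with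
  | _ m ih =>
    match m with
    | 0 => simp [halvingList]
    | m + 1 =>
      rw [halvingList, List.map_append, List.map_cons, List.sum_append, List.sum_cons]
      have key : ∀ k : ℕ, 2 * k ≤ m + 1 → (k : ℝ) ^ (1000 / 429 : ℝ) ≤
          (0.3975 / 2) * ((m + 1 : ℕ) : ℝ) ^ (1000 / 429 : ℝ) := by
        intro k hk
        have hk' : (k : ℝ) ≤ 1 / 2 * ((m + 1 : ℕ) : ℝ) := by
          have : ((2 * k : ℕ) : ℝ) ≤ ((m + 1 : ℕ) : ℝ) := by exact_mod_cast hk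
          rw [Nat.cast_mul] at this
          norm_num at this ⊢
          linarith
        calc (k : ℝ) ^ (1000 / 429 : ℝ)
            ≤ (1 / 2 * ((m + 1 : ℕ) : ℝ)) ^ (1000 / 429 : ℝ) :=
              Real.rpow_le_rpow (by positivity) hk' (by norm_num)
          _ = (1 / 2 : ℝ) ^ (1000 / 429 : ℝ) * ((m + 1 : ℕ) : ℝ) ^ (1000 / 429 : ℝ) :=
              Real.mul_rpow (by norm_num) (by positivity)
          _ ≤ _ := mul_le_mul_of_nonneg_right h2 (by positivity)
      have i1 := ih ((m + 1) / 2) (by omega)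
      have i2 := ih (m / 2) (by omega)
      have k1 := key ((m + 1) / 2) (by omega)
      have k2 := key (m / 2) (by omega)
      have pos : 0 ≤ ((m + 1 : ℕ) : ℝ) ^ (1000 / 429 : ℝ) := by positivity
      linarith

set_option exponentiation.threshold 1000 in
/-- Trees of size `O(w ^ (1000 / 429))` that force width `w`. -/
theorem exists_forcesWidth (w : ℕ) (hw : 1 ≤ w) : ∃ T : OrderedTree, T.ForcesWidth w ∧
    (T.nodes.card : ℝ) ≤ 100000 * (w : ℝ) ^ (1000 / 429 : ℝ) := by
  induction w using Nat.strong_induction_on with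
  | _ w ih =>
    rcases hw.eq_or_lt with rfl | hw2
    · exact ⟨leaf, forcesWidth_one _, by norm_num [leaf]⟩
    -- The split 19 : 13 makes `2 * (1.6598 * 0.12249 + 0.29667)` slightly less than 1; with the
    -- factor 100000 the slack absorbs the linear term `2 * w`.
    obtain ⟨t, ht⟩ : ∃ t, t = 19 * w / 32 := ⟨_, rfl⟩
    obtain ⟨m, hm⟩ : ∃ m, m = w - 1 - t := ⟨_, rfl⟩
    have hex : ∀ v : ℕ, ∃ T : OrderedTree, 1 ≤ v → v < w → T.ForcesWidth v ∧
        (T.nodes.card : ℝ) ≤ 100000 * (v : ℝ) ^ (1000 / 429 : ℝ) := by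
      intro v
      by_cases h : 1 ≤ v ∧ v < w
      · obtain ⟨T, hT⟩ := ih v h.2 h.1
        exact ⟨T, fun _ _ => hT⟩
      · exact ⟨leaf, fun h1 h2 => absurd ⟨h1, h2⟩ h⟩
    choose f hf using hex
    have hft := hf t (by omega) (by omega)
    have hfm : ∀ e ∈ halvingList m, (f e).ForcesWidth e ∧
        ((f e).nodes.card : ℝ) ≤ 100000 * (e : ℝ) ^ (1000 / 429 : ℝ) := by
      intro e he
      have := mem_halvingList he
      exact hf e this.1 (by omega)
    refine ⟨spine f (join [leaf, f t, f t]) (halvingList m), ?_, ?_⟩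
    · have := forcesWidth_spine hft.1 (infixDominated_halvingList m) fun e he => (hfm e he).1
      rw [length_halvingList] at this
      convert this using 1
      omega
    · have c1 := card_spine_le f (join [leaf, f t, f t]) (halvingList m)
      have c2 := card_join_three_le leaf (f t) (f t)
      have c3 : leaf.nodes.card = 1 := rfl
      rw [length_halvingList] at c1
      have c4 : (spine f (join [leaf, f t, f t]) (halvingList m)).nodes.card ≤
          2 * ((halvingList m).map fun e => (f e).nodes.card).sum + 2 * (f t).nodes.card
            + 2 * w := by omega
      have c5 : (((halvingList m).map fun e => (f e).nodes.card).sum : ℝ) ≤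
          100000 * (1.6598 * (m : ℝ) ^ (1000 / 429 : ℝ)) := by
        refine le_trans ?_ (mul_le_mul_of_nonneg_left (sum_halvingList_rpow_le m) (by norm_num))
        rw [← List.sum_map_mul_left, Nat.cast_list_sum, List.map_map]
        exact List.sum_le_sum fun e he => (hfm e he).2
      have c6 : ((spine f (join [leaf, f t, f t]) (halvingList m)).nodes.card : ℝ) ≤
          2 * (((halvingList m).map fun e => (f e).nodes.card).sum : ℕ)
            + 2 * ((f t).nodes.card : ℝ) + 2 * w := by exact_mod_cast c4
      have key : ∀ (k : ℕ) (a b : ℝ), 0 ≤ a → 0 ≤ b → a ^ 1000 ≤ b ^ 429 → (k : ℝ) ≤ a * w →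
          (k : ℝ) ^ (1000 / 429 : ℝ) ≤ b * (w : ℝ) ^ (1000 / 429 : ℝ) := by
        intro k a b ha hb hab hk
        calc (k : ℝ) ^ (1000 / 429 : ℝ) ≤ (a * w) ^ (1000 / 429 : ℝ) :=
              Real.rpow_le_rpow (by positivity) hk (by norm_num)
          _ = a ^ (1000 / 429 : ℝ) * (w : ℝ) ^ (1000 / 429 : ℝ) :=
              Real.mul_rpow ha (by positivity)
          _ ≤ _ := mul_le_mul_of_nonneg_right (rpow_exponent_le ha hb hab) (by positivity)
      have ht' : (t : ℝ) ≤ 19 / 32 * w := by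
        have : ((32 * t : ℕ) : ℝ) ≤ ((19 * w : ℕ) : ℝ) := by
          have : 32 * t ≤ 19 * w := by omega
          exact_mod_cast this
        push_cast at this
        linarith
      have hm' : (m : ℝ) ≤ 13 / 32 * w := by
        have : ((32 * m : ℕ) : ℝ) ≤ ((13 * w : ℕ) : ℝ) := by
          have : 32 * m ≤ 13 * w := by omega
          exact_mod_cast this
        push_cast at this
        linarith
      have kt := key t (19 / 32) 0.29667 (by norm_num) (by norm_num) (by norm_num) ht'
      have km := key m (13 / 32) 0.12249 (by norm_num) (by norm_num) (by norm_num) hm'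
      have hw1 : (1 : ℝ) ≤ w := by exact_mod_cast hw
      have kw : (w : ℝ) ≤ (w : ℝ) ^ (1000 / 429 : ℝ) := by
        simpa using Real.rpow_le_rpow_of_exponent_le hw1 (by norm_num : (1 : ℝ) ≤ 1000 / 429)
      linarith [hft.2]

end OrderedTree

/-! ### Column counts in GLR-drawings -/

namespace TreeDrawing

variable {T : OrderedTree}

/-- The grid columns that intersect the drawing of the subtree rooted at `r`. -/
def columns (Γ : TreeDrawing T) (r : List ℕ) : Set ℤ :=
  {x : ℤ | ∃ p ∈ Γ.subtreePoints r, p.re = (x : ℝ)}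

theorem isBounded_polyline (L : List ℂ) : Bornology.IsBounded (polyline L) := by
  have : polyline L ⊆ ⋃ i : Fin L.length, ⋃ j : Fin L.length, segment ℝ L[i] L[j] := by
    rintro p ⟨i, h, hp⟩
    exact Set.mem_iUnion₂.mpr ⟨⟨i, by omega⟩, ⟨i + 1, h⟩, hp⟩
  refine Bornology.IsBounded.subset ?_ this
  refine Bornology.isBounded_iUnion.mpr fun i => Bornology.isBounded_iUnion.mpr fun j => ?_
  rw [segment_eq_image]
  exact (isCompact_Icc.image (by fun_prop)).isBounded

theorem isBounded_subtreePoints (Γ : TreeDrawing T) (r : List ℕ) :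
    Bornology.IsBounded (Γ.subtreePoints r) := by
  have : Γ.subtreePoints r ⊆ ⋃ w ∈ T.nodes, ({gridPoint (Γ.pos w)} ∪ Γ.edgeCurve w) := by
    rintro p ⟨w, hw, -, hp⟩
    exact Set.mem_iUnion₂.mpr ⟨w, hw, hp.imp id And.right⟩
  refine Bornology.IsBounded.subset ?_ this
  rw [Bornology.isBounded_biUnion_finset]
  exact fun w _ => Bornology.isBounded_singleton.union (isBounded_polyline _)

theorem finite_columns (Γ : TreeDrawing T) (r : List ℕ) : (Γ.columns r).Finite := by
  obtain ⟨R, hR⟩ := (Γ.isBounded_subtreePoints r).exists_norm_le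
  refine (Set.finite_Icc (-⌈R⌉) ⌈R⌉).subset ?_
  rintro x ⟨p, hp, hx⟩
  have h1 : |(x : ℝ)| ≤ R := hx ▸ (Complex.abs_re_le_norm p).trans (hR p hp)
  have h2 : |(x : ℝ)| ≤ ⌈R⌉ := h1.trans (Int.le_ceil R)
  rw [abs_le] at h2
  exact ⟨by exact_mod_cast h2.1, by exact_mod_cast h2.2⟩

theorem columns_subset (Γ : TreeDrawing T) {r c : List ℕ} (h : r <+: c) :
    Γ.columns c ⊆ Γ.columns r := by
  rintro x ⟨p, ⟨w, hw, hcw, hp⟩, hx⟩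
  refine ⟨p, ⟨w, hw, h.trans hcw, hp.imp id fun ⟨hwc, hp⟩ => ⟨?_, hp⟩⟩, hx⟩
  -- If `w = r`, then `c`, lying between them, is also `r`, but the edge above `c` is excluded.
  rintro rfl
  exact hwc (h.eq_of_length_le hcw.length_le)

theorem ncard_columns_add_lt (Γ : TreeDrawing T) {r : List ℕ} {x : ℤ}
    (hx : x ∈ Γ.columns r) {s t : Set ℤ} (hs : s ⊆ Γ.columns r) (ht : t ⊆ Γ.columns r)
    (hst : ((∀ z ∈ s, z < x) ∧ ∀ z ∈ t, x < z) ∨ ((∀ z ∈ s, x < z) ∧ ∀ z ∈ t, z < x)) :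
    s.ncard + t.ncard + 1 ≤ (Γ.columns r).ncard := by
  have fin := Γ.finite_columns r
  have hd : Disjoint s t := Set.disjoint_left.mpr fun z h1 h2 => by
    rcases hst with h | h <;> have := h.1 z h1 <;> have := h.2 z h2 <;> omega
  have hxn : x ∉ s ∪ t := by
    rintro (h1 | h1) <;> rcases hst with h | h
    · exact (h.1 x h1).false
    · exact (h.1 x h1).false
    · exact (h.2 x h1).false
    · exact (h.2 x h1).false
  rw [← Set.ncard_union_eq hd (fin.subset hs) (fin.subset ht),
    ← Set.ncard_insert_of_notMem hxn ((fin.subset hs).union (fin.subset ht))]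
  exact Set.ncard_le_ncard (Set.insert_subset hx (Set.union_subset hs ht)) fin

theorem ncard_columns_lt (Γ : TreeDrawing T) {r : List ℕ} {x : ℤ}
    (hx : x ∈ Γ.columns r) {s : Set ℤ} (hs : s ⊆ Γ.columns r) (hxs : x ∉ s) :
    s.ncard + 1 ≤ (Γ.columns r).ncard :=
  Nat.succ_le_of_lt (Set.ncard_lt_ncard ⟨hs, fun h => hxs (h hx)⟩ (Γ.finite_columns r))

theorem prefix_of_isLeftSubtree {r l c : List ℕ} (h : T.IsLeftSubtree r l c) : r <+: c := by
  obtain ⟨u, j, k, rfl, -, hu, -, -⟩ := h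
  exact hu.1.trans (List.prefix_append u [j])

theorem prefix_of_isRightSubtree {r l c : List ℕ} (h : T.IsRightSubtree r l c) : r <+: c := by
  obtain ⟨u, j, k, rfl, -, hu, -, -⟩ := h
  exact hu.1.trans (List.prefix_append u [j])

theorem mem_nodes_of_isLeftSubtree {r l c : List ℕ} (h : T.IsLeftSubtree r l c) :
    c ∈ T.nodes := by
  obtain ⟨u, j, k, -, hc, -⟩ := h
  exact hc

theorem mem_nodes_of_isRightSubtree {r l c : List ℕ} (h : T.IsRightSubtree r l c) :
    c ∈ T.nodes := by
  obtain ⟨u, j, k, -, hc, -⟩ := h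
  exact hc

/-- A finite family of values is bounded by one of its members or is empty. -/
theorem exists_bound_attained (N : Finset (List ℕ)) (P : List ℕ → Prop) (hP : ∀ c, P c → c ∈ N)
    (ω : List ℕ → ℕ) :
    ∃ x, (∀ c, P c → ω c ≤ x) ∧ ((x = 0 ∧ ∀ c, ¬ P c) ∨ ∃ c, P c ∧ ω c = x) := by
  classical
  by_cases h : ∃ c, P c
  · obtain ⟨c₀, hc₀⟩ := h
    obtain ⟨c, hc, hmax⟩ := (N.filter P).exists_max_image ω
      ⟨c₀, Finset.mem_filter.mpr ⟨hP _ hc₀, hc₀⟩⟩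
    exact ⟨ω c, fun d hd => hmax d (Finset.mem_filter.mpr ⟨hP _ hd, hd⟩),
      Or.inr ⟨c, (Finset.mem_filter.mp hc).2, rfl⟩⟩
  · push Not at h
    exact ⟨0, fun c hc => absurd hc (h c), Or.inl ⟨rfl, h⟩⟩

theorem IsGLR.widthAssignment {Γ : TreeDrawing T} (hΓ : Γ.IsGLR) :
    T.WidthAssignment fun r => (Γ.columns r).ncard := by
  intro r hr
  obtain ⟨l, x, hl, hrl, hv, hsep⟩ := hΓ.2.2 r hr
  have hxr : x ∈ Γ.columns r :=
    ⟨gridPoint (Γ.pos r), ⟨r, hr, List.prefix_refl r, Or.inl rfl⟩, by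
      simp [gridPoint, hv.1 r ⟨List.prefix_refl r, hrl⟩]⟩
  have hnot : ∀ c, T.IsLeftSubtree r l c ∨ T.IsRightSubtree r l c → x ∉ Γ.columns c := by
    rintro c hc ⟨p, hp, hpx⟩
    exact hsep.1 c hc p hp hpx
  obtain ⟨a, ha, ha'⟩ := exists_bound_attained T.nodes (T.IsLeftSubtree r l)
    (fun c hc => mem_nodes_of_isLeftSubtree hc) fun r => (Γ.columns r).ncard
  obtain ⟨b, hb, hb'⟩ := exists_bound_attained T.nodes (T.IsRightSubtree r l)
    (fun c hc => mem_nodes_of_isRightSubtree hc) fun r => (Γ.columns r).ncard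
  refine ⟨l, a, b, hl, hrl, ⟨ha, hb⟩, ?_⟩
  have lt_of : ∀ c : List ℕ, (∀ p ∈ Γ.subtreePoints c, p.re < (x : ℝ)) →
      ∀ z ∈ Γ.columns c, z < x := by
    rintro c h z ⟨p, hp, hz⟩
    have := h p hp
    rw [hz] at this
    exact_mod_cast this
  have gt_of : ∀ c : List ℕ, (∀ p ∈ Γ.subtreePoints c, (x : ℝ) < p.re) →
      ∀ z ∈ Γ.columns c, x < z := by
    rintro c h z ⟨p, hp, hz⟩
    have := h p hp
    rw [hz] at this
    exact_mod_cast this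
  -- With a side empty there is no opposite pair to separate; then it is enough that the path's
  -- column avoids the other side.
  rcases ha' with ⟨rfl, -⟩ | ⟨c, hc, rfl⟩ <;> rcases hb' with ⟨rfl, -⟩ | ⟨d, hd, rfl⟩
  · simpa using Γ.ncard_columns_lt hxr (Set.empty_subset _) (Set.notMem_empty x)
  · simpa using Γ.ncard_columns_lt hxr (Γ.columns_subset (prefix_of_isRightSubtree hd))
      (hnot d (Or.inr hd))
  · simpa using Γ.ncard_columns_lt hxr (Γ.columns_subset (prefix_of_isLeftSubtree hc))
      (hnot c (Or.inl hc))
  · exact Γ.ncard_columns_add_lt hxr (Γ.columns_subset (prefix_of_isLeftSubtree hc))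
      (Γ.columns_subset (prefix_of_isRightSubtree hd))
      ((hsep.2 c d hc hd).imp (fun h => ⟨lt_of c h.1, gt_of d h.2⟩)
        fun h => ⟨gt_of c h.1, lt_of d h.2⟩)

theorem IsGLR.le_width {Γ : TreeDrawing T} (hΓ : Γ.IsGLR) {w : ℕ} (hT : T.ForcesWidth w) :
    w ≤ Γ.width := hT.le hΓ.widthAssignment

end TreeDrawing

/-! ### Inverting the size bound -/

theorem mainTheorem7 :
    ∃ c : ℝ, 0 < c ∧ ∀ n : ℕ, 0 < n →
      ∃ T : OrderedTree, T.nodes.card = n ∧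
        ∀ Γ : TreeDrawing T, Γ.IsGLR → c * (n : ℝ) ^ (0.429 : ℝ) ≤ (Γ.width : ℝ) := by
  refine ⟨(1 / 100000 : ℝ) ^ (0.429 : ℝ) / 2, by positivity, fun n hn => ?_⟩
  set y : ℝ := (1 / 100000 * n : ℝ) ^ (0.429 : ℝ) with hy
  have hcy : (1 / 100000 : ℝ) ^ (0.429 : ℝ) / 2 * (n : ℝ) ^ (0.429 : ℝ) = y / 2 := by
    rw [hy, Real.mul_rpow (by norm_num) (by positivity)]
    ring
  have hy0 : 0 ≤ y := by positivity
  obtain ⟨w, hyw, T, hT, hcard⟩ : ∃ w : ℕ, y / 2 ≤ w ∧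
      ∃ T : OrderedTree, T.ForcesWidth w ∧ T.nodes.card ≤ n := by
    -- Rounding `y` down loses at most a factor 2 once `y ≥ 1`; for smaller `y` a single node
    -- suffices. Chains then pad the tree to `n` nodes.
    rcases Nat.eq_zero_or_pos ⌊y⌋₊ with h | h
    · have : y < 1 := Nat.floor_eq_zero.mp h
      exact ⟨1, by norm_num; linarith, OrderedTree.leaf, OrderedTree.forcesWidth_one _, hn⟩
    · obtain ⟨T, hT, hc⟩ := OrderedTree.exists_forcesWidth ⌊y⌋₊ h
      have h1 : (1 : ℝ) ≤ (⌊y⌋₊ : ℝ) := by exact_mod_cast h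
      refine ⟨⌊y⌋₊, by linarith [Nat.lt_floor_add_one y], T, hT, ?_⟩
      have h2 : ((⌊y⌋₊ : ℕ) : ℝ) ^ (1000 / 429 : ℝ) ≤ 1 / 100000 * n :=
        calc ((⌊y⌋₊ : ℕ) : ℝ) ^ (1000 / 429 : ℝ) ≤ y ^ (1000 / 429 : ℝ) :=
              Real.rpow_le_rpow (by positivity) (Nat.floor_le hy0) (by norm_num)
          _ = 1 / 100000 * n := by
              rw [hy, ← Real.rpow_mul (by positivity)]
              norm_num
      have h3 : (T.nodes.card : ℝ) ≤ n := by linarith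
      exact_mod_cast h3
  obtain ⟨T', hn', hT'⟩ := hT.exists_card_eq hcard
  refine ⟨T', hn', fun Γ hΓ => ?_⟩
  rw [hcy]
  exact hyw.trans (by exact_mod_cast hΓ.le_width hT')
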